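/- Let $m,n,k$ be non-negative integers and let $f:[0,\infty)\to\mathbb{R}$ be concave and non-decreasing with $f(0)=0$. For $X\in\mathbb{R}^{m\times n}$ with singular values $\sigma_1(X)\ge\dots\ge\sigma_N(X)\ge 0$, $N=\min(m,n)$, put $\mathcal{R}(X)=\sum_{i=1}^{N} f(\sigma_i(X))$. For $B\in\mathbb{R}^{m\times k}$ and $C\in\mathbb{R}^{n\times k}$ with columns $B_i$ and $C_i$ put $$\tilde{\mathcal{R}}(B,C)=\sum_{i=1}^{k} f\left(\frac{\|B_i\|^2+\|C_i\|^2}{2}\right),$$ where $\|\cdot\|$ is the Euclidean norm. Then for every $X\in\mathbb{R}^{m\times n}$ with $\operatorname{rank}(X)\le k$, $$\mathcal{R}(X)=\min\left\{\tilde{\mathcal{R}}(B,C) : B\in\mathbb{R}^{m\times k},\ C\in\mathbb{R}^{n\times k},\ BC^T=X\right\},$$ and in particular the minimum is attained. Moreover, if $f$ is differentiable on $[0,\infty)$ (one-sidedly at $0$), then $\tilde{\mathcal{R}}$ is differentiable on $\mathbb{R}^{m\times k}\times\mathbb{R}^{n\times k}$. -/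

import Mathlib

-- Spaces of real matrices carry the Frobenius norm (used only to speak of differentiability).
attribute [local instance] Matrix.frobeniusNormedAddCommGroup Matrix.frobeniusNormedSpace

noncomputable section

/-- The Euclidean norm `‖B_i‖` of the `i`-th column of a real matrix `B`. -/
def colNorm {m k : ℕ} (B : Matrix (Fin m) (Fin k) ℝ) (i : Fin k) : ℝ :=
  ‖(WithLp.toLp 2 (B.col i) : EuclideanSpace ℝ (Fin m))‖

/-- The `i`-th singular value of a real `m × n` matrix, in non-increasing order with multiplicity.
Indices start at `0`, so the singular values of `X` are those with `i < min m n`. -/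
def sigma {m n : ℕ} (X : Matrix (Fin m) (Fin n) ℝ) (i : ℕ) : ℝ :=
  (Matrix.toEuclideanLin X).singularValues i

/-- `R(X) = ∑_{i=1}^N f(σ_i(X))` with `N = min(m, n)`. -/
def spectralReg {m n : ℕ} (f : ℝ → ℝ) (X : Matrix (Fin m) (Fin n) ℝ) : ℝ :=
  ∑ i ∈ Finset.range (min m n), f (sigma X i)

/-- `R̃(B, C) = ∑_{i=1}^k f((‖B_i‖² + ‖C_i‖²) / 2)`. -/
def bilinReg {m n k : ℕ} (f : ℝ → ℝ)
    (B : Matrix (Fin m) (Fin k) ℝ) (C : Matrix (Fin n) (Fin k) ℝ) : ℝ :=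
  ∑ i : Fin k, f ((colNorm B i ^ 2 + colNorm C i ^ 2) / 2)

end

open Module LinearMap
open scoped InnerProductSpace

variable {E F K : Type*}
  [NormedAddCommGroup E] [InnerProductSpace ℝ E] [FiniteDimensional ℝ E]
  [NormedAddCommGroup F] [InnerProductSpace ℝ F] [FiniteDimensional ℝ F]
  [NormedAddCommGroup K] [InnerProductSpace ℝ K] [FiniteDimensional ℝ K]

/-! Lower bound: let `S = B*B + C*C`. Its j-th eigenvalue is at least twice the j-th singular value
of `BC*` (`two_mul_singularValues_le_eigenvalues`), so monotonicity bounds the spectral sum by the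
sum of `f(λ_j / 2)`. By Schur-Horn (`sum_concave_eigenvalues_le`), concavity bounds that by the same
sum over the diagonal of `S`, whose entries are `‖B_i‖² + ‖C_i‖²`. Attainment: split each singular
value evenly, `B_i = √σ_i u_i` and `C_i = √σ_i v_i`, so that both squared norms equal `σ_i`; rank at
most `k` means that `k` columns suffice. -/

/-- The Gram operator `B* B + C* C` of a pair of linear maps. -/
noncomputable def gramSum (B : K →ₗ[ℝ] F) (C : K →ₗ[ℝ] E) : K →ₗ[ℝ] K :=
  B.adjoint ∘ₗ B + C.adjoint ∘ₗ C

theorem gramSum_isSymmetric (B : K →ₗ[ℝ] F) (C : K →ₗ[ℝ] E) : (gramSum B C).IsSymmetric :=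
  B.isSymmetric_adjoint_comp_self.add C.isSymmetric_adjoint_comp_self

theorem inner_gramSum_self (B : K →ₗ[ℝ] F) (C : K →ₗ[ℝ] E) (y : K) :
    ⟪gramSum B C y, y⟫_ℝ = ‖B y‖ ^ 2 + ‖C y‖ ^ 2 := by
  simp [gramSum, inner_add_left, adjoint_inner_left]

/-- The quadratic form of a symmetric operator in an orthonormal basis of eigenvectors. -/
theorem LinearMap.IsSymmetric.inner_apply_self_eq_sum {S : K →ₗ[ℝ] K} (hS : S.IsSymmetric)
    {k : ℕ} (hk : finrank ℝ K = k) (y : K) :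
    ⟪S y, y⟫_ℝ = ∑ a, hS.eigenvalues hk a * ⟪hS.eigenvectorBasis hk a, y⟫_ℝ ^ 2 := by
  rw [← (hS.eigenvectorBasis hk).sum_inner_mul_inner]
  refine Finset.sum_congr rfl fun a _ => ?_
  rw [hS, hS.apply_eigenvectorBasis, inner_smul_right, real_inner_comm y]
  simp only [RCLike.ofReal_real_eq_id, id_eq]
  ring

theorem gramSum_eigenvalues_nonneg (B : K →ₗ[ℝ] F) (C : K →ₗ[ℝ] E) {k : ℕ}
    (hk : finrank ℝ K = k) (a : Fin k) : 0 ≤ (gramSum_isSymmetric B C).eigenvalues hk a := by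
  set hS := gramSum_isSymmetric B C
  have h := inner_gramSum_self B C (hS.eigenvectorBasis hk a)
  rw [hS.apply_eigenvectorBasis, inner_smul_left] at h
  simp at h
  rw [h]; positivity

/-- If `y` is orthogonal to the first `j` eigenvectors, the Rayleigh quotient at `y` is at most the
eigenvalue with index `j`. -/
theorem LinearMap.IsSymmetric.inner_apply_self_le {S : K →ₗ[ℝ] K} (hS : S.IsSymmetric)
    {k : ℕ} (hk : finrank ℝ K = k) (j : Fin k) (y : K)
    (hy : ∀ a < j, ⟪hS.eigenvectorBasis hk a, y⟫_ℝ = 0) :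
    ⟪S y, y⟫_ℝ ≤ hS.eigenvalues hk j * ‖y‖ ^ 2 := by
  rw [hS.inner_apply_self_eq_sum hk, ← (hS.eigenvectorBasis hk).sum_sq_norm_inner_right y,
    Finset.mul_sum]
  refine Finset.sum_le_sum fun a _ => ?_
  rw [Real.norm_eq_abs, sq_abs]
  rcases lt_or_ge a j with h | h
  · simp [hy a h]
  · exact mul_le_mul_of_nonneg_right (hS.eigenvalues_antitone hk h) (sq_nonneg _)

/-! ### Singular vectors and the arithmetic-geometric mean inequality -/

/-- Right singular vectors of `T`. -/
noncomputable def rightSingularBasis (T : E →ₗ[ℝ] F) {n : ℕ} (hn : finrank ℝ E = n) :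
    OrthonormalBasis (Fin n) ℝ E :=
  T.isSymmetric_adjoint_comp_self.eigenvectorBasis hn

theorem inner_apply_rightSingularBasis (T : E →ₗ[ℝ] F) {n : ℕ} (hn : finrank ℝ E = n)
    (a b : Fin n) :
    ⟪T (rightSingularBasis T hn a), T (rightSingularBasis T hn b)⟫_ℝ =
      if a = b then T.singularValues a ^ 2 else 0 := by
  rw [← adjoint_inner_left, ← LinearMap.comp_apply, rightSingularBasis,
    T.isSymmetric_adjoint_comp_self.apply_eigenvectorBasis, inner_smul_left,
    orthonormal_iff_ite.mp (OrthonormalBasis.orthonormal _), T.sq_singularValues_fin hn]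
  simp

theorem norm_apply_rightSingularBasis (T : E →ₗ[ℝ] F) {n : ℕ} (hn : finrank ℝ E = n)
    (a : Fin n) : ‖T (rightSingularBasis T hn a)‖ = T.singularValues a := by
  have h := inner_apply_rightSingularBasis T hn a a
  rw [real_inner_self_eq_norm_sq, if_pos rfl] at h
  exact (sq_eq_sq₀ (norm_nonneg _) (T.singularValues_nonneg _)).mp h

/-- The arithmetic-geometric mean inequality for singular values. -/
theorem two_mul_singularValues_le_eigenvalues (B : K →ₗ[ℝ] F) (C : K →ₗ[ℝ] E) {k : ℕ}
    (hk : finrank ℝ K = k) (j : Fin k) :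
    2 * (B ∘ₗ C.adjoint).singularValues j ≤ (gramSum_isSymmetric B C).eigenvalues hk j := by
  set T := B ∘ₗ C.adjoint with hT
  set hS := gramSum_isSymmetric B C
  -- A positive `σ_j` makes `σ_0, …, σ_j` all invertible, so left singular vectors `u a` exist for
  -- these indices.
  rcases (T.singularValues_nonneg j).eq_or_lt with h0 | hpos
  · rw [← h0, mul_zero]
    exact gramSum_eigenvalues_nonneg B C hk j
  have hjE : (j : ℕ) < finrank ℝ E := by
    by_contra! h
    exact hpos.ne' (T.singularValues_of_finrank_le h)
  have hle (a : Fin (j + 1)) : T.singularValues j ≤ T.singularValues a :=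
    T.singularValues_antitone (Nat.lt_succ_iff.mp a.2)
  have hapos (a : Fin (j + 1)) : 0 < T.singularValues a := hpos.trans_le (hle a)
  let ι : Fin (j + 1) → Fin (finrank ℝ E) := Fin.castLE hjE
  let v : Fin (j + 1) → E := fun a => rightSingularBasis T rfl (ι a)
  let u : Fin (j + 1) → F := fun a => (T.singularValues a)⁻¹ • T (v a)
  have hιinj : Function.Injective ι := Fin.castLE_injective hjE
  have hv : Orthonormal ℝ v := (OrthonormalBasis.orthonormal _).comp ι hιinj
  have hTv (a : Fin (j + 1)) : T (v a) = T.singularValues a • u a := by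
    simp [u, smul_smul, (hapos a).ne']
  have hu : Orthonormal ℝ u := by
    rw [orthonormal_iff_ite]
    intro a b
    simp only [u, v, inner_smul_left, inner_smul_right, inner_apply_rightSingularBasis,
      hιinj.eq_iff]
    split_ifs with hab
    · subst hab
      have := (hapos a).ne'
      simp [ι]
      field_simp
    · simp
  let L : (Fin (j + 1) → ℝ) →ₗ[ℝ] K :=
    Fintype.linearCombination ℝ (fun a => B.adjoint (u a) + C.adjoint (v a))
  let G : K →ₗ[ℝ] (Fin j → ℝ) :=
    LinearMap.pi fun i => (innerₛₗ ℝ) (hS.eigenvectorBasis hk (Fin.castLT i (i.2.trans j.2)))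
  -- With `M y = (B y, C y)`, one has `S = M*M` and `y = M*(w₁, w₂)`. The `j + 1` coefficients can
  -- meet the `j` conditions that `y` be orthogonal to the top eigenvectors of `S`, as in
  -- Courant-Fischer.
  obtain ⟨c, hc, hc0⟩ := (Submodule.ne_bot_iff _).mp
    (LinearMap.ker_ne_bot_of_finrank_lt (f := G ∘ₗ L) (by simp))
  set w₁ : F := ∑ a, c a • u a with hw₁
  set w₂ : E := ∑ a, c a • v a with hw₂
  set y : K := B.adjoint w₁ + C.adjoint w₂ with hy
  have hLc : L c = y := by
    simp [L, hy, hw₁, hw₂, Fintype.linearCombination_apply, Finset.sum_add_distrib]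
  set N : ℝ := ∑ a, c a ^ 2 with hN
  have hNpos : 0 < N := by
    obtain ⟨a, ha⟩ := Function.ne_iff.mp hc0
    exact Finset.sum_pos' (fun _ _ => sq_nonneg _) ⟨a, Finset.mem_univ _, by
      have : c a ≠ 0 := ha
      positivity⟩
  have hn₁ : ‖w₁‖ ^ 2 = N := by
    rw [← real_inner_self_eq_norm_sq, hw₁, hu.inner_sum]
    simp [hN, sq]
  have hn₂ : ‖w₂‖ ^ 2 = N := by
    rw [← real_inner_self_eq_norm_sq, hw₂, hv.inner_sum]
    simp [hN, sq]
  have hcross : T.singularValues j * N ≤ ⟪B.adjoint w₁, C.adjoint w₂⟫_ℝ := by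
    have hTw : B (C.adjoint w₂) = ∑ a, (c a * T.singularValues a) • u a := by
      rw [← LinearMap.comp_apply, ← hT, hw₂, map_sum]
      simp [hTv, smul_smul]
    rw [adjoint_inner_left, hTw, hw₁, hu.inner_sum, hN, Finset.mul_sum]
    refine Finset.sum_le_sum fun a _ => ?_
    have := mul_le_mul_of_nonneg_right (hle a) (sq_nonneg (c a))
    simp only [conj_trivial]
    linarith
  -- `‖p + q‖² ≥ 4⟪p, q⟫`, which is where the arithmetic-geometric mean enters.
  have hlow : 4 * (T.singularValues j * N) ≤ ‖y‖ ^ 2 := by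
    have h1 := norm_add_sq_real (B.adjoint w₁) (C.adjoint w₂)
    have h2 := norm_sub_sq_real (B.adjoint w₁) (C.adjoint w₂)
    have h3 := sq_nonneg ‖B.adjoint w₁ - C.adjoint w₂‖
    rw [← hy] at h1
    linarith
  have hray : ‖B y‖ ^ 2 + ‖C y‖ ^ 2 ≤ hS.eigenvalues hk j * ‖y‖ ^ 2 := by
    rw [← inner_gramSum_self]
    refine hS.inner_apply_self_le hk j y fun a ha => ?_
    have h := congrFun (LinearMap.mem_ker.mp hc) ⟨a, ha⟩
    simpa [G, hLc] using h
  have hup : ‖y‖ ^ 2 ≤ ‖w₁‖ * ‖B y‖ + ‖w₂‖ * ‖C y‖ := by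
    calc ‖y‖ ^ 2 = ⟪w₁, B y⟫_ℝ + ⟪w₂, C y⟫_ℝ := by
          rw [← real_inner_self_eq_norm_sq, ← adjoint_inner_left, ← adjoint_inner_left,
            ← inner_add_left, ← hy]
      _ ≤ _ := add_le_add (real_inner_le_norm _ _) (real_inner_le_norm _ _)
  have hypos : 0 < ‖y‖ ^ 2 := lt_of_lt_of_le (by positivity) hlow
  -- Cauchy-Schwarz for `‖y‖² = ⟪(w₁, w₂), M y⟫`, where `‖(w₁, w₂)‖² = 2N`.
  have hsq : (‖y‖ ^ 2) ^ 2 ≤ 2 * N * (‖B y‖ ^ 2 + ‖C y‖ ^ 2) := by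
    calc (‖y‖ ^ 2) ^ 2 ≤ (‖w₁‖ * ‖B y‖ + ‖w₂‖ * ‖C y‖) ^ 2 := by gcongr
      _ ≤ 2 * (‖w₁‖ ^ 2 * ‖B y‖ ^ 2 + ‖w₂‖ ^ 2 * ‖C y‖ ^ 2) := by
          nlinarith [sq_nonneg (‖w₁‖ * ‖B y‖ - ‖w₂‖ * ‖C y‖)]
      _ = _ := by rw [hn₁, hn₂]; ring
  have h1 : ‖y‖ ^ 2 ≤ 2 * N * hS.eigenvalues hk j := by
    refine le_of_mul_le_mul_right ?_ hypos
    calc ‖y‖ ^ 2 * ‖y‖ ^ 2 ≤ 2 * N * (‖B y‖ ^ 2 + ‖C y‖ ^ 2) := by rw [← sq]; exact hsq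
      _ ≤ 2 * N * (hS.eigenvalues hk j * ‖y‖ ^ 2) := by gcongr
      _ = _ := by ring
  refine le_of_mul_le_mul_left ?_ (mul_pos two_pos hNpos)
  linarith

/-- The Schur-Horn inequality for a concave function: passing from the eigenvalues to the diagonal
in an orthonormal basis increases the trace function. -/
theorem LinearMap.IsSymmetric.sum_concave_eigenvalues_le {S : K →ₗ[ℝ] K} (hS : S.IsSymmetric)
    {k : ℕ} (hk : finrank ℝ K = k) {ι : Type*} [Fintype ι] (e : OrthonormalBasis ι ℝ K)
    {s : Set ℝ} {g : ℝ → ℝ} (hg : ConcaveOn ℝ s g) (hs : ∀ a, hS.eigenvalues hk a ∈ s) :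
    ∑ a, g (hS.eigenvalues hk a) ≤ ∑ i, g ⟪S (e i), e i⟫_ℝ := by
  -- The squared coefficients are doubly stochastic: row sums give the weights for Jensen, column
  -- sums recover each eigenvalue term once.
  have hrow (i : ι) : ∑ a, ⟪hS.eigenvectorBasis hk a, e i⟫_ℝ ^ 2 = 1 := by
    have := (hS.eigenvectorBasis hk).sum_sq_norm_inner_right (e i)
    simpa using this
  have hcol (a : Fin k) : ∑ i, ⟪hS.eigenvectorBasis hk a, e i⟫_ℝ ^ 2 = 1 := by
    have := e.sum_sq_norm_inner_left (hS.eigenvectorBasis hk a)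
    simpa using this
  calc ∑ a, g (hS.eigenvalues hk a)
      = ∑ a, ∑ i, ⟪hS.eigenvectorBasis hk a, e i⟫_ℝ ^ 2 * g (hS.eigenvalues hk a) := by
        simp [← Finset.sum_mul, hcol]
    _ = ∑ i, ∑ a, ⟪hS.eigenvectorBasis hk a, e i⟫_ℝ ^ 2 * g (hS.eigenvalues hk a) :=
        Finset.sum_comm
    _ ≤ ∑ i, g ⟪S (e i), e i⟫_ℝ := by
        refine Finset.sum_le_sum fun i _ => ?_
        have h := hg.le_map_sum (t := Finset.univ) (fun a _ => sq_nonneg _) (hrow i)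
          (fun a _ => hs a)
        simp only [smul_eq_mul] at h
        rw [hS.inner_apply_self_eq_sum hk]
        simpa only [mul_comm] using h

/-- Singular values vanish past the rank and `f 0 = 0`, so any two cutoffs above the rank agree;
this trades `min m n` for `k`. -/
theorem sum_range_singularValues_eq_sum_fin (T : E →ₗ[ℝ] F) {f : ℝ → ℝ} (h0 : f 0 = 0) {N k : ℕ}
    (hN : finrank ℝ T.range ≤ N) (hk : finrank ℝ T.range ≤ k) :
    ∑ i ∈ Finset.range N, f (T.singularValues i) = ∑ i : Fin k, f (T.singularValues i) := by
  rw [Fin.sum_univ_eq_sum_range (fun i => f (T.singularValues i))]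
  have key {M : ℕ} (hM : finrank ℝ T.range ≤ M) :
      ∑ i ∈ Finset.range (finrank ℝ T.range), f (T.singularValues i) =
        ∑ i ∈ Finset.range M, f (T.singularValues i) := by
    refine Finset.sum_subset (Finset.range_mono hM) fun i _ hi => ?_
    rw [← T.support_singularValues, Finsupp.notMem_support_iff] at hi
    rw [hi, h0]
  rw [← key hN, ← key hk]

/-- The concave spectral function of `B C*` is bounded by the bilinear expression. -/
theorem sum_singularValues_comp_adjoint_le {ι : Type*} [Fintype ι] {f : ℝ → ℝ}
    (hconc : ConcaveOn ℝ (Set.Ici 0) f) (hmono : MonotoneOn f (Set.Ici 0))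
    (B : K →ₗ[ℝ] F) (C : K →ₗ[ℝ] E) {k : ℕ} (hk : finrank ℝ K = k)
    (e : OrthonormalBasis ι ℝ K) :
    ∑ j : Fin k, f ((B ∘ₗ C.adjoint).singularValues j) ≤
      ∑ i, f ((‖B (e i)‖ ^ 2 + ‖C (e i)‖ ^ 2) / 2) := by
  set hS := gramSum_isSymmetric B C
  have hnn := gramSum_eigenvalues_nonneg B C hk
  have hg : ConcaveOn ℝ (Set.Ici 0) fun x => f (x / 2) := by
    refine ⟨convex_Ici 0, fun x hx y hy a b ha hb hab => ?_⟩
    have hx' : x / 2 ∈ Set.Ici (0 : ℝ) := by simp only [Set.mem_Ici] at *; linarith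
    have hy' : y / 2 ∈ Set.Ici (0 : ℝ) := by simp only [Set.mem_Ici] at *; linarith
    have h := hconc.2 hx' hy' ha hb hab
    simp only [smul_eq_mul] at *
    rwa [show (a * x + b * y) / 2 = a * (x / 2) + b * (y / 2) by ring]
  calc ∑ j : Fin k, f ((B ∘ₗ C.adjoint).singularValues j)
      ≤ ∑ j : Fin k, f (hS.eigenvalues hk j / 2) := by
        refine Finset.sum_le_sum fun j _ => hmono (LinearMap.singularValues_nonneg _ _) ?_ ?_
        · exact div_nonneg (hnn j) two_pos.le
        · have := two_mul_singularValues_le_eigenvalues B C hk j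
          linarith
    _ ≤ ∑ i, f (⟪gramSum B C (e i), e i⟫_ℝ / 2) :=
        hS.sum_concave_eigenvalues_le hk e hg hnn
    _ = _ := by simp only [inner_gramSum_self]

/-! ### The balanced factorization -/

/-- The `i`-th right singular vector, extended by zero beyond the dimension of the domain. -/
noncomputable def rightSingularVector (T : E →ₗ[ℝ] F) (i : ℕ) : E :=
  if h : i < finrank ℝ E then rightSingularBasis T rfl ⟨i, h⟩ else 0

theorem norm_apply_rightSingularVector (T : E →ₗ[ℝ] F) (i : ℕ) :
    ‖T (rightSingularVector T i)‖ = T.singularValues i := by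
  unfold rightSingularVector
  split_ifs with h
  · exact norm_apply_rightSingularBasis T rfl ⟨i, h⟩
  · simp [T.singularValues_of_finrank_le (not_lt.mp h)]

/-- The vector has norm one except past the dimension, where the singular value is zero anyway. -/
theorem singularValues_mul_norm_rightSingularVector (T : E →ₗ[ℝ] F) (i : ℕ) :
    T.singularValues i * ‖rightSingularVector T i‖ ^ 2 = T.singularValues i := by
  unfold rightSingularVector
  split_ifs with h
  · simp
  · simp [T.singularValues_of_finrank_le (not_lt.mp h)]

/-- Expand `x` in the right singular basis; terms past the rank drop out because `‖T v_i‖ = σ_i =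
0`. -/
theorem apply_eq_sum_rightSingularVector (T : E →ₗ[ℝ] F) {k : ℕ} (hk : finrank ℝ T.range ≤ k)
    (x : E) :
    T x = ∑ i : Fin k, ⟪rightSingularVector T i, x⟫_ℝ • T (rightSingularVector T i) := by
  let g : ℕ → F := fun i => ⟪rightSingularVector T i, x⟫_ℝ • T (rightSingularVector T i)
  have hg {i : ℕ} (hi : finrank ℝ T.range ≤ i) : g i = 0 := by
    have h : T (rightSingularVector T i) = 0 := by
      rw [← norm_eq_zero, norm_apply_rightSingularVector, ← Finsupp.notMem_support_iff,
        T.support_singularValues]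
      simpa using hi
    simp [g, h]
  have key {M : ℕ} (hM : finrank ℝ T.range ≤ M) :
      ∑ i ∈ Finset.range (finrank ℝ T.range), g i = ∑ i ∈ Finset.range M, g i :=
    Finset.sum_subset (Finset.range_mono hM) fun i _ hi => hg (by simpa using hi)
  calc T x = ∑ i : Fin (finrank ℝ E), g i := by
        conv_lhs => rw [← (rightSingularBasis T rfl).sum_repr' x, map_sum]
        simp [g, rightSingularVector]
    _ = ∑ i : Fin k, g i := by
        rw [Fin.sum_univ_eq_sum_range g, Fin.sum_univ_eq_sum_range g, ← key T.finrank_range_le,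
          ← key hk]

theorem finrank_range_toEuclideanLin {m n : ℕ} (X : Matrix (Fin m) (Fin n) ℝ) :
    finrank ℝ (Matrix.toEuclideanLin X).range = X.rank := by
  rw [Matrix.toEuclideanLin, Matrix.toLpLin_eq_toLin, ← Matrix.rank_eq_finrank_range_toLin]

theorem toEuclideanLin_mul_transpose {m n k : ℕ} (B : Matrix (Fin m) (Fin k) ℝ)
    (C : Matrix (Fin n) (Fin k) ℝ) :
    Matrix.toEuclideanLin (B * C.transpose) =
      Matrix.toEuclideanLin B ∘ₗ (Matrix.toEuclideanLin C).adjoint := by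
  rw [← Matrix.toEuclideanLin_conjTranspose_eq_adjoint, Matrix.conjTranspose_eq_transpose_of_trivial]
  ext x : 1
  simp [Matrix.toLpLin_apply]

theorem norm_toEuclideanLin_basisFun {m k : ℕ} (B : Matrix (Fin m) (Fin k) ℝ) (i : Fin k) :
    ‖Matrix.toEuclideanLin B (EuclideanSpace.basisFun (Fin k) ℝ i)‖ = colNorm B i := by
  rw [colNorm, Matrix.toLpLin_apply]
  simp

theorem spectralReg_eq_sum_fin {m n k : ℕ} {f : ℝ → ℝ} (h0 : f 0 = 0)
    {X : Matrix (Fin m) (Fin n) ℝ} (hX : X.rank ≤ k) :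
    spectralReg f X = ∑ i : Fin k, f (sigma X i) := by
  refine sum_range_singularValues_eq_sum_fin (Matrix.toEuclideanLin X) h0 ?_ ?_ <;>
    rw [finrank_range_toEuclideanLin]
  · simpa using ⟨X.rank_le_height, X.rank_le_width⟩
  · exact hX

theorem spectralReg_mul_transpose_le_bilinReg {m n k : ℕ} {f : ℝ → ℝ}
    (hconc : ConcaveOn ℝ (Set.Ici 0) f) (hmono : MonotoneOn f (Set.Ici 0)) (h0 : f 0 = 0)
    (B : Matrix (Fin m) (Fin k) ℝ) (C : Matrix (Fin n) (Fin k) ℝ) :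
    spectralReg f (B * C.transpose) ≤ bilinReg f B C := by
  have hrank : (B * C.transpose).rank ≤ k := (Matrix.rank_mul_le_left _ _).trans B.rank_le_width
  have h := sum_singularValues_comp_adjoint_le hconc hmono (Matrix.toEuclideanLin B)
    (Matrix.toEuclideanLin C) finrank_euclideanSpace_fin (EuclideanSpace.basisFun (Fin k) ℝ)
  simp only [norm_toEuclideanLin_basisFun] at h
  rw [spectralReg_eq_sum_fin h0 hrank]
  simpa only [sigma, toEuclideanLin_mul_transpose, bilinReg] using h

/-- The left factor of the balanced factorization obtained from a singular value decomposition. -/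
noncomputable def balancedLeft {m n : ℕ} (X : Matrix (Fin m) (Fin n) ℝ) (k : ℕ) :
    Matrix (Fin m) (Fin k) ℝ :=
  Matrix.of fun a i => (√(sigma X i))⁻¹ *
    Matrix.toEuclideanLin X (rightSingularVector (Matrix.toEuclideanLin X) i) a

/-- The right factor of the balanced factorization obtained from a singular value decomposition. -/
noncomputable def balancedRight {m n : ℕ} (X : Matrix (Fin m) (Fin n) ℝ) (k : ℕ) :
    Matrix (Fin n) (Fin k) ℝ :=
  Matrix.of fun b i => √(sigma X i) * rightSingularVector (Matrix.toEuclideanLin X) i b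

theorem colNorm_sq_balancedLeft {m n k : ℕ} (X : Matrix (Fin m) (Fin n) ℝ) (i : Fin k) :
    colNorm (balancedLeft X k) i ^ 2 = sigma X i := by
  have h : (WithLp.toLp 2 ((balancedLeft X k).col i) : EuclideanSpace ℝ (Fin m)) =
      (√(sigma X i))⁻¹ •
        Matrix.toEuclideanLin X (rightSingularVector (Matrix.toEuclideanLin X) i) := by
    ext a; simp [balancedLeft]
  have hs : 0 ≤ sigma X i := LinearMap.singularValues_nonneg _ _
  rw [colNorm, h, norm_smul, norm_apply_rightSingularVector, mul_pow, norm_inv, inv_pow,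
    Real.norm_eq_abs, sq_abs, Real.sq_sqrt hs]
  change (sigma X i)⁻¹ * sigma X i ^ 2 = _
  -- For `σ_i = 0` the convention `0⁻¹ = 0` makes the column zero, as needed.
  rcases eq_or_ne (sigma X i) 0 with h | h
  · simp [h]
  · field_simp

theorem colNorm_sq_balancedRight {m n k : ℕ} (X : Matrix (Fin m) (Fin n) ℝ) (i : Fin k) :
    colNorm (balancedRight X k) i ^ 2 = sigma X i := by
  have h : (WithLp.toLp 2 ((balancedRight X k).col i) : EuclideanSpace ℝ (Fin n)) =
      √(sigma X i) • rightSingularVector (Matrix.toEuclideanLin X) i := by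
    ext a; simp [balancedRight]
  have hs : 0 ≤ sigma X i := LinearMap.singularValues_nonneg _ _
  rw [colNorm, h, norm_smul, mul_pow, Real.norm_eq_abs, sq_abs, Real.sq_sqrt hs]
  exact singularValues_mul_norm_rightSingularVector _ _

theorem balancedLeft_mul_transpose_balancedRight {m n k : ℕ} {X : Matrix (Fin m) (Fin n) ℝ}
    (hX : X.rank ≤ k) : balancedLeft X k * (balancedRight X k).transpose = X := by
  set T := Matrix.toEuclideanLin X with hT
  ext a b
  have h := congrArg (fun w : EuclideanSpace ℝ (Fin m) => w a)
    (apply_eq_sum_rightSingularVector T ((finrank_range_toEuclideanLin X).trans_le hX)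
      (EuclideanSpace.basisFun (Fin n) ℝ b))
  have hl : T (EuclideanSpace.basisFun (Fin n) ℝ b) a = X a b := by
    simp [hT, Matrix.toLpLin_apply]
  simp only [hl] at h
  rw [h, Matrix.mul_apply]
  simp only [WithLp.ofLp_sum, WithLp.ofLp_smul, Finset.sum_apply, Pi.smul_apply, smul_eq_mul,
    Matrix.transpose_apply]
  refine Finset.sum_congr rfl fun i _ => ?_
  have hin : ⟪rightSingularVector T i, EuclideanSpace.basisFun (Fin n) ℝ b⟫_ℝ =
      rightSingularVector T i b := by
    rw [real_inner_comm, EuclideanSpace.basisFun_inner]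
  simp only [hin, balancedLeft, balancedRight, Matrix.of_apply, ← hT]
  rcases (T.singularValues_nonneg i).eq_or_lt with h0 | hpos
  · have hz : T (rightSingularVector T i) = 0 := by
      rw [← norm_eq_zero, norm_apply_rightSingularVector, ← h0]
    simp [hz]
  · have : √(sigma X i) ≠ 0 := (Real.sqrt_pos.mpr hpos).ne'
    field_simp

theorem bilinReg_balanced {m n k : ℕ} {f : ℝ → ℝ} (h0 : f 0 = 0)
    {X : Matrix (Fin m) (Fin n) ℝ} (hX : X.rank ≤ k) :
    bilinReg f (balancedLeft X k) (balancedRight X k) = spectralReg f X := by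
  rw [spectralReg_eq_sum_fin h0 hX, bilinReg]
  simp only [colNorm_sq_balancedLeft, colNorm_sq_balancedRight, add_self_div_two]

/-! ### Differentiability -/

theorem differentiable_colNorm_sq {m k : ℕ} (i : Fin k) :
    Differentiable ℝ fun B : Matrix (Fin m) (Fin k) ℝ => colNorm B i ^ 2 := by
  simp only [colNorm, EuclideanSpace.real_norm_sq_eq, Matrix.col_apply]
  refine Differentiable.fun_sum fun a _ => Differentiable.pow ?_ 2
  exact (LinearMap.toContinuousLinearMap (Matrix.entryLinearMap ℝ ℝ a i)).differentiable

/-- The argument of `f` is a polynomial in the entries with values in `[0, ∞)`, so the chain rule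
needs only one-sided differentiability of `f` at zero. -/
theorem differentiable_bilinReg {m n k : ℕ} {f : ℝ → ℝ} (hf : DifferentiableOn ℝ f (Set.Ici 0)) :
    Differentiable ℝ
      (fun p : Matrix (Fin m) (Fin k) ℝ × Matrix (Fin n) (Fin k) ℝ => bilinReg f p.1 p.2) := by
  unfold bilinReg
  refine Differentiable.fun_sum fun i _ => ?_
  rw [← differentiableOn_univ]
  refine hf.comp (t := Set.Ici 0)
    (f := fun p : Matrix (Fin m) (Fin k) ℝ × Matrix (Fin n) (Fin k) ℝ =>
      (colNorm p.1 i ^ 2 + colNorm p.2 i ^ 2) / 2) ?_ fun p _ => ?_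
  · have hB : Differentiable ℝ fun p : Matrix (Fin m) (Fin k) ℝ × Matrix (Fin n) (Fin k) ℝ =>
        colNorm p.1 i ^ 2 := fun p =>
      (differentiable_colNorm_sq i p.1).comp p differentiableAt_fst
    have hC : Differentiable ℝ fun p : Matrix (Fin m) (Fin k) ℝ × Matrix (Fin n) (Fin k) ℝ =>
        colNorm p.2 i ^ 2 := fun p =>
      (differentiable_colNorm_sq i p.2).comp p differentiableAt_snd
    have h : Differentiable ℝ fun p : Matrix (Fin m) (Fin k) ℝ × Matrix (Fin n) (Fin k) ℝ =>
        colNorm p.1 i ^ 2 + colNorm p.2 i ^ 2 := hB.add hC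
    simp only [div_eq_mul_inv]
    exact (h.mul_const (2 : ℝ)⁻¹).differentiableOn
  · simp only [Set.mem_Ici]
    positivity

theorem corollary1 (m n k : ℕ) (f : ℝ → ℝ)
    (hconc : ConcaveOn ℝ (Set.Ici 0) f) (hmono : MonotoneOn f (Set.Ici 0)) (h0 : f 0 = 0) :
    (∀ X : Matrix (Fin m) (Fin n) ℝ, X.rank ≤ k →
      IsLeast {r : ℝ | ∃ (B : Matrix (Fin m) (Fin k) ℝ) (C : Matrix (Fin n) (Fin k) ℝ),
          X = B * C.transpose ∧ r = bilinReg f B C}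
        (spectralReg f X)) ∧
    (DifferentiableOn ℝ f (Set.Ici 0) →
      Differentiable ℝ
        (fun p : Matrix (Fin m) (Fin k) ℝ × Matrix (Fin n) (Fin k) ℝ => bilinReg f p.1 p.2)) := by
  refine ⟨fun X hX => ⟨⟨balancedLeft X k, balancedRight X k, ?_, ?_⟩, ?_⟩,
    differentiable_bilinReg⟩
  · exact (balancedLeft_mul_transpose_balancedRight hX).symm
  · exact (bilinReg_balanced h0 hX).symm
  · rintro r ⟨B, C, rfl, rfl⟩
    exact spectralReg_mul_transpose_le_bilinReg hconc hmono h0 B C
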